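/- **Uncensored lower bound.** Consider a bandit with $K$ arms, conversion rates $\theta=(\theta_1,\dots,\theta_K)\in[0,1]^K$, and a known delay distribution on $\mathbb N=\{0,1,2,\dots\}$ with finite mean. At each round $t=1,2,\dots$ the learner plays an arm $A_t$; then, given the past, a conversion indicator $C_t\sim\mathrm{Bernoulli}(\theta_{A_t})$ and, independently of it, a delay $D_t$ from the delay distribution are drawn, neither being shown directly to the learner. At the end of round $t$ the learner observes all the contributions $X_{s,t}=C_s\mathbf 1\{D_s\le t-s\}$, $1\le s\le t$, and the reward of round $t$ is $Y_t=\sum_{s=1}^t C_s\mathbf 1\{D_s=t-s\}$. An algorithm chooses $A_{t+1}$, possibly at random, as a function of the past arms $A_1,\dots,A_t$ and of the observations $(X_{s,u})_{1\le s\le u\le t}$. Let $k^*$ be an optimal arm, $\theta^*=\theta_{k^*}=\max_k\theta_k$, and let the regret be $$R(T)=\mathbb E\Big[r^*(T)-\sum_{t=1}^T Y_t\Big],$$ where $r^*(T)$ is the cumulated reward over $T$ rounds of the oracle that always plays $k^*$. An algorithm is *uniformly efficient* (for the given delay distribution) if, for every vector of conversion rates in $[0,1]^K$ with a unique optimal arm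 and every $\alpha\in(0,1)$, $R(T)/T^\alpha\to0$ as $T\to\infty$. Then for every uniformly efficient algorithm and every $\theta\in[0,1]^K$, $$\liminf_{T\to\infty}\frac{R(T)}{\log T}\ \ge\ \sum_{k:\,\theta_k<\theta^*}\frac{\theta^*-\theta_k}{d(\theta_k,\theta^*)},$$ where $d(p,q)=p\log\frac pq+(1-p)\log\frac{1-p}{1-q}$ is the Kullback–Leibler divergence between the Bernoulli distributions with parameters $p$ and $q$ (with $0\log 0=0$; if $\theta^*=1$ then $d(\theta_k,\theta^*)=+\infty$ for $\theta_k<1$ and the corresponding terms are $0$). If the optimal arm $k^*$ is unique, the sum is over all $k\ne k^*$. -/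

import Mathlib

open Filter Topology

noncomputable section

namespace DelayedBandit

/-- What the environment draws in one round: the arm `A` that is played, the conversion
indicator `C`, and the delay `D`. The learner does not see `C` and `D` themselves. -/
structure Round (K : ℕ) where
  arm : Fin K
  conv : Bool
  delay : ℕ

/-- The trajectory of the first `T` rounds. The index `s : Fin T` (that is `0, …, T - 1`) stands
for round `s + 1`. -/
abbrev Trajectory (K T : ℕ) := Fin T → Round K

/-- `X_{s,u} = C_s 𝟙{D_s ≤ u - s}` (and `false` when `u < s`): whether the conversion of the
action of round `s` has been disclosed by the end of round `u`. -/
def contribution {K T : ℕ} (ω : Trajectory K T) (s u : Fin T) : Bool :=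
  (ω s).conv && decide ((s : ℕ) + (ω s).delay ≤ (u : ℕ))

/-- `Y_t = ∑_{s ≤ t} C_s 𝟙{D_s = t - s}`: the number of conversions disclosed at round `t`. -/
def reward {K T : ℕ} (ω : Trajectory K T) (t : Fin T) : ℕ :=
  ∑ s : Fin T, if (ω s).conv = true ∧ (s : ℕ) + (ω s).delay = (t : ℕ) then 1 else 0

/-- `r(T) = ∑_{t ≤ T} Y_t`, the cumulated reward. -/
def cumReward {K T : ℕ} (ω : Trajectory K T) : ℕ :=
  ∑ t : Fin T, reward ω t

/-- A (possibly randomized) policy with `K` arms. After `t` rounds it draws the next arm from a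
law that depends only on the arms played so far and on the observed contributions
`(X_{s,u})_{s ≤ u ≤ t}`. Deterministic policies are those whose values are point masses. -/
abbrev Policy (K : ℕ) :=
  (t : ℕ) → (Fin t → Fin K) → (Fin t → Fin t → Bool) → PMF (Fin K)

/-- The policy that plays arm `a` at every round. -/
def constPolicy {K : ℕ} (a : Fin K) : Policy K := fun _ _ _ => PMF.pure a

/-- The Bernoulli distribution with parameter `p`. -/
def bernoulliPMF (p : unitInterval) : PMF Bool :=
  PMF.ofFintype (fun b => ENNReal.ofReal (if b then (p : ℝ) else 1 - (p : ℝ))) (by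
    rw [Fintype.sum_bool]
    simp only [if_true, Bool.false_eq_true, if_false]
    rw [← ENNReal.ofReal_add p.2.1 (sub_nonneg.2 p.2.2)]
    simp)

/-- The law of the trajectory of the first `T` rounds when the policy `π` faces the uncensored
model with conversion rates `θ` and delay distribution `δ`: given the past, the arm `A` is drawn
from the policy, and then `C ∼ Bernoulli(θ_A)` and `D ∼ δ` are drawn independently. -/
def law {K : ℕ} (θ : Fin K → unitInterval) (δ : PMF ℕ) (π : Policy K) :
    (T : ℕ) → PMF (Trajectory K T)
  | 0 => PMF.pure Fin.elim0
  | T + 1 =>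
    (law θ δ π T).bind fun ω =>
      (π T (fun s => (ω s).arm) (contribution ω)).bind fun a =>
        (bernoulliPMF (θ a)).bind fun c =>
          δ.bind fun d =>
            PMF.pure (Fin.snoc (α := fun _ => Round K) ω ⟨a, c, d⟩)

/-- `E[r(T)]`. The sum converges, because `0 ≤ r(T) ≤ T`. -/
def expectedReward {K : ℕ} (θ : Fin K → unitInterval) (δ : PMF ℕ) (π : Policy K) (T : ℕ) : ℝ :=
  ∑' ω : Trajectory K T, (law θ δ π T ω).toReal * (cumReward ω : ℝ)

/-- The expected regret `R(T) = E[r*(T) - r(T)]`, where `r*(T)` is the cumulated reward of the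
oracle that plays the arm `a` (meant to be an optimal one) at every round. -/
def regret {K : ℕ} (θ : Fin K → unitInterval) (δ : PMF ℕ) (a : Fin K) (π : Policy K)
    (T : ℕ) : ℝ :=
  expectedReward θ δ (constPolicy a) T - expectedReward θ δ π T

/-- Uniform efficiency of a policy for the (known) delay distribution `δ`: for all conversion
rates with a unique optimal arm and all `α ∈ (0, 1)`, `R(T) / T ^ α → 0`. -/
def UniformlyEfficient {K : ℕ} (δ : PMF ℕ) (π : Policy K) : Prop :=
  ∀ (θ : Fin K → unitInterval) (a : Fin K), (∀ k, k ≠ a → θ k < θ a) →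
    ∀ α : ℝ, 0 < α → α < 1 →
      Tendsto (fun T : ℕ => regret θ δ a π T / (T : ℝ) ^ α) atTop (𝓝 0)

open Classical in
/-- The Kullback–Leibler divergence `d(p, q)` between the Bernoulli distributions with parameters
`p, q ∈ [0, 1]`, with `0 log 0 = 0`; it is `+∞` when the first distribution is not absolutely
continuous with respect to the second. -/
def bernoulliKL (p q : ℝ) : EReal :=
  if (q = 0 ∧ p ≠ 0) ∨ (q = 1 ∧ p ≠ 1) then ⊤
  else ((p * Real.log (p / q) + (1 - p) * Real.log ((1 - p) / (1 - q)) : ℝ) : EReal)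

end DelayedBandit

end

/-!
The argument compares `θ` with the rates `θ'` in which one suboptimal arm `k` has been lifted to a
value `q` slightly above `θ*`, so that `k` is the unique optimal arm of `θ'`. The likelihood ratio
of whole trajectories, hidden conversions and delays included, involves only the conversions of the
arm `k`, since the policy and the delay distribution are the same in both models. A linearized
Donsker–Varadhan inequality (`expect_law_add_one_le`), applied to `x (T - N_k) / T` where `N_k` is
the number of plays of `k`, gives (`mul_one_sub_expectedPlays_le`)

`x (1 - E_θ[N_k] / T) ≤ d(θ_k, q) E_θ[N_k] + exp x / T * E_θ'[T - N_k]`.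

Uniform efficiency at `θ'` gives `E_θ'[T - N_k] = o(T ^ α)`, so `x = (1 - α) log T` makes the last
term vanish, and `E_θ[N_k]` is asymptotically at least `(1 - α) log T / d(θ_k, q)`; then `α → 0`
and `q → θ*` (`eventually_mul_log_le_expectedPlays`). Nothing is asked of the policy at `θ` itself,
so several arms may be optimal there.

A conversion is lost to the regret comparison only if it is disclosed after the horizon, and the
expected number of those is at most the mean delay. Hence the regret is at least
`∑ k, (θ* - θ_k) E_θ[N_k]` minus a constant (`regret_bounds`): at `θ'` this turns efficiency into a
bound on `E_θ'[T - N_k]`, and at `θ` it turns the bounds on `E_θ[N_k]` into the bound on the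
regret.
-/

noncomputable section

namespace DelayedBandit

/-! ### Expectations under discrete laws -/

/-- The expectation of a nonnegative function under a discrete law, as an extended nonnegative
real, so that no summability conditions arise. -/
def expect {α : Type*} (p : PMF α) (f : α → ENNReal) : ENNReal := ∑' a, p a * f a

section Expect

variable {α β : Type*}

lemma expect_bind (p : PMF α) (q : α → PMF β) (f : β → ENNReal) :
    expect (p.bind q) f = expect p fun a => expect (q a) f := by
  simp only [expect, PMF.bind_apply, ← ENNReal.tsum_mul_right, ← ENNReal.tsum_mul_left]
  rw [ENNReal.tsum_comm]
  simp only [mul_assoc]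

lemma expect_pure (a : α) (f : α → ENNReal) : expect (PMF.pure a) f = f a := by
  classical
  rw [expect, tsum_eq_single a]
  · simp
  · intro b hb
    simp [hb]

lemma expect_mono (p : PMF α) {f g : α → ENNReal} (h : ∀ a, f a ≤ g a) :
    expect p f ≤ expect p g :=
  ENNReal.tsum_le_tsum fun a => mul_le_mul_right (h a) _

lemma expect_add (p : PMF α) (f g : α → ENNReal) :
    expect p (fun a => f a + g a) = expect p f + expect p g := by
  simp only [expect, mul_add, ENNReal.tsum_add]

lemma expect_const_mul (p : PMF α) (c : ENNReal) (f : α → ENNReal) :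
    expect p (fun a => c * f a) = c * expect p f := by
  simp only [expect, ← ENNReal.tsum_mul_left, mul_left_comm]

lemma expect_const (p : PMF α) (c : ENNReal) : expect p (fun _ => c) = c := by
  simp only [expect, ENNReal.tsum_mul_right, p.tsum_coe, one_mul]

lemma expect_sum {ι : Type*} (p : PMF α) (s : Finset ι) (f : ι → α → ENNReal) :
    expect p (fun a => ∑ i ∈ s, f i a) = ∑ i ∈ s, expect p (f i) := by
  classical
  induction s using Finset.induction_on with
  | empty => simp [expect]
  | insert i s hi ih => simp only [Finset.sum_insert hi, expect_add, ih]

end Expect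

/-! ### The law of the trajectory, one round at a time -/

variable {K : ℕ}

/-- The Bernoulli mass function, as a real number. -/
def bernoulliMass (p : ℝ) (c : Bool) : ℝ := if c then p else 1 - p

lemma bernoulliMass_nonneg (p : unitInterval) (c : Bool) : 0 ≤ bernoulliMass p c := by
  cases c
  · simpa [bernoulliMass] using p.2.2
  · simpa [bernoulliMass] using p.2.1

lemma bernoulliPMF_apply (p : unitInterval) (c : Bool) :
    bernoulliPMF p c = ENNReal.ofReal (bernoulliMass p c) := rfl

/-- The trajectory `ω` followed by one more round. -/
abbrev extend {T : ℕ} (ω : Trajectory K T) (r : Round K) : Trajectory K (T + 1) :=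
  Fin.snoc (α := fun _ => Round K) ω r

/-- The expectation over the next round, given that its arm is drawn from `q`. -/
def roundExpect (θ : Fin K → unitInterval) (δ : PMF ℕ) (q : PMF (Fin K))
    (f : Round K → ENNReal) : ENNReal :=
  expect q fun a => expect (bernoulliPMF (θ a)) fun c => expect δ fun d => f ⟨a, c, d⟩

lemma expect_law_zero (θ : Fin K → unitInterval) (δ : PMF ℕ) (π : Policy K)
    (f : Trajectory K 0 → ENNReal) : expect (law θ δ π 0) f = f Fin.elim0 := by
  rw [law, expect_pure]

lemma expect_law_succ (θ : Fin K → unitInterval) (δ : PMF ℕ) (π : Policy K) (T : ℕ)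
    (f : Trajectory K (T + 1) → ENNReal) :
    expect (law θ δ π (T + 1)) f =
      expect (law θ δ π T) fun ω =>
        roundExpect θ δ (π T (fun s => (ω s).arm) (contribution ω)) fun r => f (extend ω r) := by
  simp only [law, expect_bind, expect_pure, roundExpect]

/-- Each round contributes to the expectation of an additive functional through its conditional
mean given the arm played. -/
lemma expect_law_sum (θ : Fin K → unitInterval) (δ : PMF ℕ) (π : Policy K)
    (h : ℕ → Round K → ENNReal) (T : ℕ) :
    expect (law θ δ π T) (fun ω => ∑ s : Fin T, h s (ω s)) =
      expect (law θ δ π T) fun ω => ∑ s : Fin T,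
        expect (bernoulliPMF (θ (ω s).arm)) fun c =>
        expect δ fun d => h s ⟨(ω s).arm, c, d⟩ := by
  induction T with
  | zero => simp [expect_law_zero]
  | succ T ih =>
    simp only [expect_law_succ, Fin.sum_univ_castSucc, extend, Fin.snoc_castSucc, Fin.snoc_last,
      Fin.val_castSucc, Fin.val_last, roundExpect, expect_add, expect_const]
    rw [ih]

lemma expect_law_constPolicy (θ : Fin K → unitInterval) (δ : PMF ℕ) (a : Fin K)
    (h : ℕ → Fin K → ENNReal) (T : ℕ) :
    expect (law θ δ (constPolicy a) T) (fun ω => ∑ s : Fin T, h s (ω s).arm) =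
      ∑ s : Fin T, h s a := by
  induction T with
  | zero => simp [expect_law_zero]
  | succ T ih =>
    simp only [expect_law_succ, Fin.sum_univ_castSucc, extend, Fin.snoc_castSucc, Fin.snoc_last,
      Fin.val_castSucc, Fin.val_last, roundExpect, expect_add, expect_const, constPolicy,
      expect_pure]
    rw [← ih]

/-! ### Change of measure -/

/-- The real-valued Kullback–Leibler divergence between Bernoulli laws; it is meaningful when the
first law is absolutely continuous with respect to the second. -/
def realKL (p q : ℝ) : ℝ :=
  p * Real.log (p / q) + (1 - p) * Real.log ((1 - p) / (1 - q))

/-- The log-likelihood ratio of a conversion indicator. It is `0`, by the conventions for division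
and logarithm, on outcomes that one of the two laws does not charge. -/
def logRatio (p q : ℝ) (c : Bool) : ℝ := Real.log (bernoulliMass p c / bernoulliMass q c)

lemma realKL_self (p : ℝ) : realKL p p = 0 := by
  have h : ∀ x : ℝ, Real.log (x / x) = 0 := fun x => by
    rcases eq_or_ne x 0 with rfl | hx
    · simp
    · simp [div_self hx]
  simp [realKL, h]

lemma sub_le_mul_log_div {p q : ℝ} (hp : 0 ≤ p) (hq : 0 < q) : p - q ≤ p * Real.log (p / q) := by
  rcases hp.eq_or_lt with rfl | hp
  · simpa using hq.le
  · have h := Real.one_sub_inv_le_log_of_pos (div_pos hp hq)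
    calc p - q = p * (1 - (p / q)⁻¹) := by field_simp
      _ ≤ _ := mul_le_mul_of_nonneg_left h hp.le

lemma realKL_nonneg {p q : ℝ} (hp0 : 0 ≤ p) (hp1 : p ≤ 1) (hq0 : 0 < q) (hq1 : q < 1) :
    0 ≤ realKL p q := by
  have h1 := sub_le_mul_log_div hp0 hq0
  have h2 := sub_le_mul_log_div (sub_nonneg.2 hp1) (sub_pos.2 hq1)
  unfold realKL
  linarith

lemma realKL_pos {p q : ℝ} (hp0 : 0 ≤ p) (hpq : p < q) (hq1 : q < 1) :
    0 < realKL p q := by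
  have hq0 : 0 < q := hp0.trans_lt hpq
  have h1 := sub_le_mul_log_div hp0 hq0
  have h2 : 1 - p - (1 - q) < (1 - p) * Real.log ((1 - p) / (1 - q)) := by
    have hq : 0 < 1 - q := sub_pos.2 hq1
    have hp : 0 < 1 - p := by linarith
    have hne : (1 - q) / (1 - p) ≠ 1 := by
      rw [Ne, div_eq_one_iff_eq hp.ne']
      linarith
    have h := Real.log_lt_sub_one_of_pos (div_pos hq hp) hne
    have h3 : Real.log ((1 - p) / (1 - q)) = -Real.log ((1 - q) / (1 - p)) := by
      rw [← Real.log_inv, inv_div]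
    rw [h3]
    calc 1 - p - (1 - q) = (1 - p) * (-((1 - q) / (1 - p) - 1)) := by field_simp; ring
      _ < _ := mul_lt_mul_of_pos_left (neg_lt_neg h) hp
  unfold realKL
  linarith

lemma expect_bernoulliPMF_ofReal (p : unitInterval) (g : Bool → ℝ) (hg : ∀ c, 0 ≤ g c) :
    expect (bernoulliPMF p) (fun c => ENNReal.ofReal (g c)) =
      ENNReal.ofReal (p * g true + (1 - p) * g false) := by
  have h1 := mul_nonneg p.2.1 (hg true)
  have h2 := mul_nonneg (sub_nonneg.2 p.2.2) (hg false)
  rw [ENNReal.ofReal_add h1 h2, ENNReal.ofReal_mul p.2.1, ENNReal.ofReal_mul (sub_nonneg.2 p.2.2)]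
  simp [expect, tsum_fintype, bernoulliPMF_apply, bernoulliMass]

/-- Reweighting the law under `θ` by the inverse likelihood ratio gives at most the law
under `θ'`: there is equality where the law under `θ` charges the trajectory. The laws of the arms
and of the delays do not depend on the rates, so they cancel. -/
lemma expect_law_mul_ratio_le (θ θ' : Fin K → unitInterval)
    (hac : ∀ a c, bernoulliMass (θ' a) c = 0 → bernoulliMass (θ a) c = 0)
    (δ : PMF ℕ) (π : Policy K) (T : ℕ) (W : Trajectory K T → ENNReal) :
    expect (law θ δ π T) (fun ω => (∏ s, ENNReal.ofReal (Real.exp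
        (-logRatio (θ (ω s).arm) (θ' (ω s).arm) (ω s).conv))) * W ω) ≤
      expect (law θ' δ π T) W := by
  have key : ∀ a c, ENNReal.ofReal (bernoulliMass (θ a) c) * ENNReal.ofReal (Real.exp
      (-logRatio (θ a) (θ' a) c)) ≤ ENNReal.ofReal (bernoulliMass (θ' a) c) := by
    intro a c
    rw [← ENNReal.ofReal_mul (bernoulliMass_nonneg _ _)]
    apply ENNReal.ofReal_le_ofReal
    rcases (bernoulliMass_nonneg (θ a) c).eq_or_lt with h | h
    · rw [← h, zero_mul]
      exact bernoulliMass_nonneg _ _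
    · have h' : 0 < bernoulliMass (θ' a) c :=
        (bernoulliMass_nonneg _ _).lt_of_ne fun h0 => h.ne' (hac a c h0.symm)
      rw [logRatio, Real.exp_neg, Real.exp_log (div_pos h h'), inv_div, mul_div_cancel₀ _ h.ne']
  induction T with
  | zero => simp [expect_law_zero]
  | succ T ih =>
    simp only [expect_law_succ, Fin.prod_univ_castSucc, extend, Fin.snoc_castSucc, Fin.snoc_last]
    refine le_trans (expect_mono _ fun ω => ?_) (ih _)
    simp only [roundExpect, mul_assoc, expect_const_mul]
    gcongr
    refine expect_mono _ fun a => ENNReal.tsum_le_tsum fun c => ?_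
    rw [← mul_assoc, bernoulliPMF_apply, bernoulliPMF_apply]
    exact mul_le_mul_left (key a c) _

/-- The Donsker–Varadhan inequality for the laws of the trajectory, in the linearized form that
comes from `log x ≤ x - 1`, with the divergence split up along the rounds. -/
lemma expect_law_add_one_le (θ θ' : Fin K → unitInterval)
    (hac : ∀ a c, bernoulliMass (θ' a) c = 0 → bernoulliMass (θ a) c = 0)
    (hkl : ∀ a, 0 ≤ realKL (θ a) (θ' a))
    (δ : PMF ℕ) (π : Policy K) (T : ℕ) (u : Trajectory K T → ℝ) (hu : ∀ ω, 0 ≤ u ω) :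
    expect (law θ δ π T) (fun ω => ENNReal.ofReal (u ω)) + 1 ≤
      expect (law θ δ π T)
          (fun ω => ∑ s, ENNReal.ofReal (realKL (θ (ω s).arm) (θ' (ω s).arm))) +
        expect (law θ' δ π T) fun ω => ENNReal.ofReal (Real.exp (u ω)) := by
  -- Adding `M` per round makes the log-likelihood ratio nonnegative.
  obtain ⟨M, hM0, hM⟩ : ∃ M : ℝ, 0 ≤ M ∧ ∀ a c, 0 ≤ logRatio (θ a) (θ' a) c + M := by
    refine ⟨∑ x : Fin K × Bool, |logRatio (θ x.1) (θ' x.1) x.2|,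
      Finset.sum_nonneg fun _ _ => abs_nonneg _, fun a c => ?_⟩
    have := Finset.single_le_sum (f := fun x : Fin K × Bool => |logRatio (θ x.1) (θ' x.1) x.2|)
      (fun _ _ => abs_nonneg _) (Finset.mem_univ (a, c))
    have := neg_abs_le (logRatio (θ a) (θ' a) c)
    simp only at *
    linarith
  have h1 : expect (law θ δ π T) (fun ω => ∑ s, ENNReal.ofReal
        (logRatio (θ (ω s).arm) (θ' (ω s).arm) (ω s).conv + M)) =
      expect (law θ δ π T)
          (fun ω => ∑ s, ENNReal.ofReal (realKL (θ (ω s).arm) (θ' (ω s).arm))) +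
        ENNReal.ofReal (T * M) := by
    rw [expect_law_sum θ δ π
      (fun _ r => ENNReal.ofReal (logRatio (θ r.arm) (θ' r.arm) r.conv + M)) T,
      ← expect_const (law θ δ π T) (ENNReal.ofReal (T * M)), ← expect_add]
    congr 1
    funext ω
    have h2 : ENNReal.ofReal (T * M) = ∑ s : Fin T, ENNReal.ofReal M := by
      simp [ENNReal.ofReal_mul]
    rw [h2, ← Finset.sum_add_distrib]
    refine Finset.sum_congr rfl fun s _ => ?_
    simp only [expect_const]
    rw [expect_bernoulliPMF_ofReal _ _ fun c => hM _ c, ← ENNReal.ofReal_add (hkl _) hM0]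
    congr 1
    simp only [logRatio, bernoulliMass, realKL, if_true, Bool.false_eq_true, if_false]
    ring
  have h3 : ∀ ω : Trajectory K T, ENNReal.ofReal (u ω) + 1 + ENNReal.ofReal (T * M) ≤
      (∑ s, ENNReal.ofReal (logRatio (θ (ω s).arm) (θ' (ω s).arm) (ω s).conv + M)) +
        (∏ s, ENNReal.ofReal (Real.exp
          (-logRatio (θ (ω s).arm) (θ' (ω s).arm) (ω s).conv))) *
            ENNReal.ofReal (Real.exp (u ω)) := by
    intro ω
    have hTM : 0 ≤ (T : ℝ) * M := by positivity
    rw [← ENNReal.ofReal_sum_of_nonneg fun s _ => hM _ _,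
      ← ENNReal.ofReal_prod_of_nonneg fun s _ => (Real.exp_pos _).le, ← Real.exp_sum,
      ← ENNReal.ofReal_mul (Real.exp_pos _).le, ← Real.exp_add, ← ENNReal.ofReal_one,
      ← ENNReal.ofReal_add (hu ω) zero_le_one,
      ← ENNReal.ofReal_add (add_nonneg (hu ω) zero_le_one) hTM,
      ← ENNReal.ofReal_add (Finset.sum_nonneg fun s _ => hM _ _) (Real.exp_pos _).le]
    apply ENNReal.ofReal_le_ofReal
    have h := Real.add_one_le_exp
      (∑ s, -logRatio (θ (ω s).arm) (θ' (ω s).arm) (ω s).conv + u ω)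
    rw [Finset.sum_neg_distrib] at h ⊢
    rw [Finset.sum_add_distrib]
    simp only [Finset.sum_const, Finset.card_univ, Fintype.card_fin, nsmul_eq_mul]
    linarith
  have h4 := expect_mono (law θ δ π T) h3
  simp only [expect_add, expect_const] at h4
  rw [h1] at h4
  have h5 := h4.trans (add_le_add_right (expect_law_mul_ratio_le θ θ' hac δ π T _) _)
  exact (ENNReal.add_le_add_iff_right ENNReal.ofReal_ne_top).1
    (h5.trans_eq (add_right_comm _ _ _))

/-! ### Expected numbers of plays -/

/-- The expected number of plays of the arm `k` in the first `T` rounds. -/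
def expectedPlays (θ : Fin K → unitInterval) (δ : PMF ℕ) (π : Policy K) (k : Fin K)
    (T : ℕ) : ℝ :=
  (expect (law θ δ π T) fun ω => ∑ s, if (ω s).arm = k then 1 else 0).toReal

lemma expectedPlays_nonneg (θ : Fin K → unitInterval) (δ : PMF ℕ) (π : Policy K) (k : Fin K)
    (T : ℕ) : 0 ≤ expectedPlays θ δ π k T :=
  ENNReal.toReal_nonneg

lemma expect_law_sum_arm (θ : Fin K → unitInterval) (δ : PMF ℕ) (π : Policy K) (T : ℕ)
    (f : Fin K → ℝ) (hf : ∀ a, 0 ≤ f a) :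
    expect (law θ δ π T) (fun ω => ∑ s, ENNReal.ofReal (f (ω s).arm)) =
      ENNReal.ofReal (∑ a, f a * expectedPlays θ δ π a T) := by
  have hfin : ∀ a, expect (law θ δ π T) (fun ω => ∑ s, if (ω s).arm = a then 1 else 0) ≠ ⊤ := by
    refine fun a => ne_top_of_le_ne_top (ENNReal.natCast_ne_top T) ?_
    rw [← expect_const (law θ δ π T) (T : ENNReal)]
    refine expect_mono _ fun ω => ?_
    calc (∑ s : Fin T, if (ω s).arm = a then (1 : ENNReal) else 0) ≤ ∑ s : Fin T, 1 :=
          Finset.sum_le_sum fun s _ => by split_ifs <;> simp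
      _ = T := by simp
  rw [ENNReal.ofReal_sum_of_nonneg fun a _ =>
    mul_nonneg (hf a) (expectedPlays_nonneg θ δ π a T)]
  simp only [ENNReal.ofReal_mul (hf _), expectedPlays, ENNReal.ofReal_toReal (hfin _),
    ← expect_const_mul]
  rw [← expect_sum]
  congr 1
  funext ω
  simp only [Finset.mul_sum]
  rw [Finset.sum_comm]
  simp

lemma sum_expectedPlays (θ : Fin K → unitInterval) (δ : PMF ℕ) (π : Policy K) (T : ℕ) :
    ∑ a, expectedPlays θ δ π a T = T := by
  have h := expect_law_sum_arm θ δ π T (fun _ => 1) fun _ => zero_le_one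
  simp only [ENNReal.ofReal_one, Finset.sum_const, Finset.card_univ, Fintype.card_fin,
    nsmul_eq_mul, mul_one, one_mul, expect_const] at h
  rw [← ENNReal.ofReal_natCast, ENNReal.ofReal_eq_ofReal_iff (by positivity)
    (Finset.sum_nonneg fun a _ => expectedPlays_nonneg θ δ π a T)] at h
  exact h.symm

lemma sum_ite_ne_expectedPlays (θ : Fin K → unitInterval) (δ : PMF ℕ) (π : Policy K) (T : ℕ)
    (k : Fin K) (x : ℝ) :
    ∑ a, (if a = k then 0 else x) * expectedPlays θ δ π a T =
      x * (T - expectedPlays θ δ π k T) := by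
  rw [← sum_expectedPlays θ δ π T, ← Finset.add_sum_erase _ _ (Finset.mem_univ k),
    ← Finset.add_sum_erase _ _ (Finset.mem_univ k), add_sub_cancel_left, Finset.mul_sum]
  simp only [if_true, zero_mul, zero_add]
  exact Finset.sum_congr rfl fun a ha => by rw [if_neg (Finset.ne_of_mem_erase ha)]

/-- If the rates differ only in the arm `k`, then the divergence between the laws is the expected
number of plays of `k` times the divergence of one conversion, and few plays of `k` under `θ` force
many plays of other arms under `θ'`. The tested functional is `x` times the proportion of rounds
not spent on `k`, whose exponential is at most `1 + Z exp x` by convexity. -/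
lemma mul_one_sub_expectedPlays_le (θ θ' : Fin K → unitInterval) (k : Fin K)
    (hne : ∀ a, a ≠ k → θ' a = θ a) (h0 : 0 < (θ' k : ℝ)) (h1 : (θ' k : ℝ) < 1)
    (δ : PMF ℕ) (π : Policy K) (T : ℕ) (hT : 0 < T) (x : ℝ) (hx : 0 ≤ x) :
    x / T * (T - expectedPlays θ δ π k T) ≤
      realKL (θ k) (θ' k) * expectedPlays θ δ π k T +
        Real.exp x / T * (T - expectedPlays θ' δ π k T) := by
  have hT' : (0 : ℝ) < T := by exact_mod_cast hT
  have hac : ∀ a c, bernoulliMass (θ' a) c = 0 → bernoulliMass (θ a) c = 0 := by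
    intro a c h
    by_cases ha : a = k
    · subst ha
      cases c <;>
        simp only [bernoulliMass, if_true, Bool.false_eq_true, if_false] at h <;> linarith
    · rwa [← hne a ha]
  have hkl' : ∀ a, realKL (θ a) (θ' a) = if a = k then realKL (θ k) (θ' k) else 0 := by
    intro a
    split_ifs with ha
    · rw [ha]
    · rw [hne a ha, realKL_self]
  have hkl : ∀ a, 0 ≤ realKL (θ a) (θ' a) := by
    intro a
    rw [hkl' a]
    split_ifs
    · exact realKL_nonneg (θ k).2.1 (θ k).2.2 h0 h1
    · exact le_rfl
  have hi : ∀ y : ℝ, 0 ≤ y → ∀ a, 0 ≤ if a = k then 0 else y := fun y hy a => by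
    split_ifs <;> simp [hy]
  have hxT : 0 ≤ x / T := by positivity
  have heT : 0 ≤ Real.exp x / T := by positivity
  have h := expect_law_add_one_le θ θ' hac hkl δ π T
    (fun ω => ∑ s, if (ω s).arm = k then 0 else x / T)
    fun ω => Finset.sum_nonneg fun s _ => hi _ hxT _
  have hexp : ∀ ω : Trajectory K T,
      ENNReal.ofReal (Real.exp (∑ s, if (ω s).arm = k then 0 else x / T)) ≤
        (∑ s, ENNReal.ofReal (if (ω s).arm = k then 0 else Real.exp x / T)) + 1 := by
    intro ω
    rw [← ENNReal.ofReal_sum_of_nonneg fun s _ => hi _ heT _, ← ENNReal.ofReal_one,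
      ← ENNReal.ofReal_add (Finset.sum_nonneg fun s _ => hi _ heT _) zero_le_one]
    apply ENNReal.ofReal_le_ofReal
    set Z : ℝ := (∑ s, if (ω s).arm = k then 0 else 1) / T with hZ
    have hsum : ∀ y : ℝ, (∑ s, if (ω s).arm = k then 0 else y / T) = Z * y := by
      intro y
      rw [hZ, div_mul_eq_mul_div, Finset.sum_mul, Finset.sum_div]
      refine Finset.sum_congr rfl fun s _ => ?_
      split_ifs <;> simp
    have hZ0 : 0 ≤ Z := div_nonneg (Finset.sum_nonneg fun s _ => hi _ zero_le_one _) hT'.le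
    have hZ1 : Z ≤ 1 := by
      rw [hZ, div_le_one hT']
      calc (∑ s, if (ω s).arm = k then (0 : ℝ) else 1) ≤ ∑ s : Fin T, 1 :=
            Finset.sum_le_sum fun s _ => by split_ifs <;> simp
        _ = T := by simp
    rw [hsum, hsum]
    have hc := convexOn_exp.2 (Set.mem_univ x) (Set.mem_univ 0) hZ0 (sub_nonneg.2 hZ1)
      (add_sub_cancel Z 1)
    simp only [smul_eq_mul, mul_zero, add_zero, Real.exp_zero, mul_one] at hc
    linarith
  have h2 := h.trans (add_le_add_right (expect_mono _ hexp) _)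
  simp only [ENNReal.ofReal_sum_of_nonneg fun s _ => hi _ hxT _, expect_add, expect_const] at h2
  rw [← add_assoc] at h2
  have h3 := (ENNReal.add_le_add_iff_right ENNReal.one_ne_top).1 h2
  rw [expect_law_sum_arm θ δ π T (fun a => if a = k then 0 else x / T) (hi _ hxT),
    expect_law_sum_arm θ δ π T (fun a => realKL (θ a) (θ' a)) hkl,
    expect_law_sum_arm θ' δ π T (fun a => if a = k then 0 else Real.exp x / T) (hi _ heT),
    ← ENNReal.ofReal_add
      (Finset.sum_nonneg fun a _ => mul_nonneg (hkl a) (expectedPlays_nonneg _ _ _ _ _))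
      (Finset.sum_nonneg fun a _ => mul_nonneg (hi _ heT a) (expectedPlays_nonneg _ _ _ _ _)),
    ENNReal.ofReal_le_ofReal_iff (add_nonneg
      (Finset.sum_nonneg fun a _ => mul_nonneg (hkl a) (expectedPlays_nonneg _ _ _ _ _))
      (Finset.sum_nonneg fun a _ => mul_nonneg (hi _ heT a) (expectedPlays_nonneg _ _ _ _ _))),
    sum_ite_ne_expectedPlays, sum_ite_ne_expectedPlays] at h3
  rwa [Finset.sum_eq_single k (fun b _ hb => by rw [hne b hb, realKL_self, zero_mul])
    fun h => absurd (Finset.mem_univ k) h] at h3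

/-! ### The regret -/

/-- The probability that a conversion of round `s + 1` is disclosed within the first `T` rounds. -/
def onTime (δ : PMF ℕ) (T s : ℕ) : ENNReal := expect δ fun d => if s + d < T then 1 else 0

lemma one_le_onTime_add (δ : PMF ℕ) (T s : ℕ) :
    1 = onTime δ T s + expect δ fun d => if s + d < T then 0 else 1 := by
  rw [onTime, ← expect_add]
  conv_lhs => rw [← expect_const δ 1]
  congr 1
  funext d
  split_ifs <;> simp

lemma onTime_le_one (δ : PMF ℕ) (T s : ℕ) : onTime δ T s ≤ 1 := by
  rw [one_le_onTime_add δ T s]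
  exact le_self_add

/-- The expected number of rounds whose delay runs past the horizon is at most the mean delay: a
delay `d` runs past it only from one of the last `d` rounds. -/
lemma sum_late_le (δ : PMF ℕ) (T : ℕ) :
    ∑ s : Fin T, expect δ (fun d => if (s : ℕ) + d < T then 0 else 1) ≤
      ∑' n : ℕ, (n : ENNReal) * δ n := by
  rw [← expect_sum]
  refine ENNReal.tsum_le_tsum fun d => ?_
  rw [mul_comm (d : ENNReal)]
  gcongr
  beta_reduce
  rw [Fin.sum_univ_eq_sum_range (fun s => if s + d < T then (0 : ENNReal) else 1) T]
  have h : (∑ s ∈ Finset.range T, if s + d < T then (0 : ENNReal) else 1) =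
      ((Finset.range T).filter fun s => ¬ s + d < T).card := by
    rw [Finset.card_filter, Nat.cast_sum]
    exact Finset.sum_congr rfl fun s _ => by split_ifs <;> simp
  rw [h, Nat.cast_le]
  calc _ ≤ (Finset.Ico (T - d) T).card := Finset.card_le_card fun s hs => by
        simp only [Finset.mem_filter, Finset.mem_range, Finset.mem_Ico] at hs ⊢
        omega
    _ ≤ d := by rw [Nat.card_Ico]; omega

lemma cumReward_eq {T : ℕ} (ω : Trajectory K T) :
    cumReward ω = ∑ s, if (ω s).conv = true ∧ (s : ℕ) + (ω s).delay < T then 1 else 0 := by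
  simp only [cumReward, reward]
  rw [Finset.sum_comm]
  refine Finset.sum_congr rfl fun s _ => ?_
  split_ifs with h
  · rw [Finset.sum_eq_single ⟨(s : ℕ) + (ω s).delay, h.2⟩]
    · simp [h.1]
    · rintro t - ht
      rw [if_neg]
      rintro ⟨-, h'⟩
      exact ht (Fin.ext h'.symm)
    · simp
  · refine Finset.sum_eq_zero fun t _ => ?_
    rw [if_neg]
    rintro ⟨h1, h2⟩
    exact h ⟨h1, h2 ▸ t.2⟩

lemma expect_cumReward (θ : Fin K → unitInterval) (δ : PMF ℕ) (π : Policy K) (T : ℕ) :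
    expect (law θ δ π T) (fun ω => (cumReward ω : ENNReal)) =
      expect (law θ δ π T) fun ω =>
        ∑ s : Fin T, ENNReal.ofReal (θ (ω s).arm) * onTime δ T s := by
  have h := expect_law_sum θ δ π
    (fun s r => if r.conv = true ∧ s + r.delay < T then 1 else 0) T
  simp only [cumReward_eq, Nat.cast_sum, Nat.cast_ite, Nat.cast_one, Nat.cast_zero]
  rw [h]
  congr 1
  funext ω
  refine Finset.sum_congr rfl fun s _ => ?_
  simp [expect, bernoulliPMF_apply, bernoulliMass, onTime, tsum_fintype]

lemma expectedReward_eq (θ : Fin K → unitInterval) (δ : PMF ℕ) (π : Policy K) (T : ℕ) :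
    expectedReward θ δ π T =
      (expect (law θ δ π T) fun ω => (cumReward ω : ENNReal)).toReal := by
  rw [expectedReward, expect, ENNReal.tsum_toReal_eq]
  · simp
  · exact fun ω => ENNReal.mul_ne_top (PMF.apply_ne_top _ _) (ENNReal.natCast_ne_top _)

/-- The regret is nonnegative, because a round spent on a worse arm can only lose conversions
disclosed in time; and it falls short of the sum of the gaps times the expected numbers of plays by
at most the mean delay, which bounds the number of conversions disclosed too late. -/
lemma regret_bounds (θ : Fin K → unitInterval) (δ : PMF ℕ)
    (hmean : ∑' n : ℕ, (n : ENNReal) * δ n ≠ ⊤) (a : Fin K) (ha : ∀ k, θ k ≤ θ a)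
    (π : Policy K) (T : ℕ) :
    0 ≤ regret θ δ a π T ∧
      ∑ k, ((θ a : ℝ) - θ k) * expectedPlays θ δ π k T ≤
        regret θ δ a π T + (∑' n : ℕ, (n : ENNReal) * δ n).toReal := by
  have hgap : ∀ k, 0 ≤ (θ a : ℝ) - θ k := fun k => sub_nonneg.2 (ha k)
  set L := expect (law θ δ π T) fun ω =>
    ∑ s : Fin T, ENNReal.ofReal ((θ a : ℝ) - θ (ω s).arm) * onTime δ T s with hL
  have hsum : expect (law θ δ (constPolicy a) T) (fun ω => (cumReward ω : ENNReal)) =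
      expect (law θ δ π T) (fun ω => (cumReward ω : ENNReal)) + L := by
    rw [expect_cumReward, expect_cumReward, hL, ← expect_add,
      expect_law_constPolicy θ δ a (fun s k => ENNReal.ofReal (θ k) * onTime δ T s),
      ← expect_const (law θ δ π T) (∑ s : Fin T, ENNReal.ofReal (θ a) * onTime δ T s)]
    congr 1
    funext ω
    rw [← Finset.sum_add_distrib]
    refine Finset.sum_congr rfl fun s _ => ?_
    rw [← add_mul, ← ENNReal.ofReal_add (θ _).2.1 (hgap _), add_sub_cancel]
  have hfin : expect (law θ δ (constPolicy a) T) (fun ω => (cumReward ω : ENNReal)) ≠ ⊤ := by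
    rw [expect_cumReward,
      expect_law_constPolicy θ δ a (fun s k => ENNReal.ofReal (θ k) * onTime δ T s)]
    exact ENNReal.sum_ne_top.2 fun s _ => ENNReal.mul_ne_top ENNReal.ofReal_ne_top
      (ne_top_of_le_ne_top ENNReal.one_ne_top (onTime_le_one δ T s))
  have hL' : L ≠ ⊤ := ne_top_of_le_ne_top hfin (hsum ▸ le_add_self)
  have hR : regret θ δ a π T = L.toReal := by
    rw [hsum] at hfin
    rw [regret, expectedReward_eq, expectedReward_eq, hsum,
      ENNReal.toReal_add (ne_top_of_le_ne_top hfin le_self_add) hL', add_sub_cancel_left]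
  refine ⟨hR ▸ ENNReal.toReal_nonneg, ?_⟩
  rw [hR, ← ENNReal.toReal_add hL' hmean, ← ENNReal.ofReal_le_iff_le_toReal
    (ENNReal.add_ne_top.2 ⟨hL', hmean⟩),
    ← expect_law_sum_arm θ δ π T (fun k => (θ a : ℝ) - θ k) hgap]
  refine le_trans ?_ (add_le_add_right (sum_late_le δ T) _)
  rw [hL, ← expect_const (law θ δ π T) (∑ s : Fin T, _), ← expect_add]
  refine expect_mono _ fun ω => ?_
  rw [← Finset.sum_add_distrib]
  refine Finset.sum_le_sum fun s _ => ?_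
  conv_lhs => rw [← mul_one (ENNReal.ofReal _), one_le_onTime_add δ T s, mul_add]
  gcongr
  refine mul_le_of_le_one_left' (ENNReal.ofReal_le_one.2 ?_)
  have := (θ a).2.2
  have := (θ (ω s).arm).2.1
  linarith

/-! ### Asymptotics -/

/-- A suboptimal arm `k` is played at least `c log T` times for every `c` below
`1 / d(θ k, θ*)`, because the policy is efficient for the rates in which `k` has been lifted just
above `θ*`. Efficiency is not needed at `θ` itself, so ties among the optimal arms do no harm. -/
lemma eventually_mul_log_le_expectedPlays (δ : PMF ℕ)
    (hmean : ∑' n : ℕ, (n : ENNReal) * δ n ≠ ⊤) (π : Policy K) (hπ : UniformlyEfficient δ π)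
    (θ : Fin K → unitInterval) (kstar : Fin K) (hstar : ∀ k, θ k ≤ θ kstar)
    (hlt1 : (θ kstar : ℝ) < 1) (k : Fin K) (hk : θ k < θ kstar) (c : ℝ) (hc0 : 0 ≤ c)
    (hc : c * realKL (θ k) (θ kstar) < 1) :
    ∀ᶠ T : ℕ in atTop, c * Real.log T ≤ expectedPlays θ δ π k T := by
  have hpos : 0 < (θ kstar : ℝ) := (θ k).2.1.trans_lt hk
  obtain ⟨q, hq, hq1, hcq⟩ : ∃ q : ℝ, (θ kstar : ℝ) < q ∧ q < 1 ∧ c * realKL (θ k) q < 1 := by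
    have hcont : ContinuousAt (fun q : ℝ => c * realKL (θ k) q) (θ kstar) := by
      have hlog : ∀ p : ℝ, (fun q : ℝ => p * Real.log (p / q)) =ᶠ[𝓝 (θ kstar : ℝ)]
          fun q => if p = 0 then 0 else p * (Real.log p - Real.log q) := by
        intro p
        filter_upwards [eventually_ne_nhds hpos.ne'] with q hq
        split_ifs with hp
        · simp [hp]
        · rw [Real.log_div hp hq]
      have hlog' : ∀ p : ℝ, (fun q : ℝ => p * Real.log (p / (1 - q))) =ᶠ[𝓝 (θ kstar : ℝ)]
          fun q => if p = 0 then 0 else p * (Real.log p - Real.log (1 - q)) := by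
        intro p
        filter_upwards [eventually_ne_nhds hlt1.ne] with q hq
        split_ifs with hp
        · simp [hp]
        · rw [Real.log_div hp (sub_ne_zero.2 hq.symm)]
      refine continuousAt_const.mul (ContinuousAt.add ?_ ?_)
      · refine ContinuousAt.congr ?_ (hlog (θ k)).symm
        split_ifs
        · exact continuousAt_const
        · exact continuousAt_const.mul (continuousAt_const.sub (Real.continuousAt_log hpos.ne'))
      · refine ContinuousAt.congr ?_ (hlog' (1 - (θ k : ℝ))).symm
        split_ifs
        · exact continuousAt_const
        · exact continuousAt_const.mul (continuousAt_const.sub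
            ((continuousAt_const.sub continuousAt_id).log (sub_ne_zero.2 hlt1.ne')))
    have h := (hcont.eventually (gt_mem_nhds hc)).filter_mono
      (nhdsWithin_le_nhds (s := Set.Ioi (θ kstar : ℝ)))
    obtain ⟨q, h1, h2⟩ := (h.and (Ioo_mem_nhdsGT hlt1)).exists
    exact ⟨q, h2.1, h2.2, h1⟩
  have hq0 : 0 < q := hpos.trans hq
  set κ := realKL (θ k) q
  have hκ : 0 ≤ κ := realKL_nonneg (θ k).2.1 (θ k).2.2 hq0 hq1
  have hcκ : 0 ≤ c * κ := mul_nonneg hc0 hκ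
  obtain ⟨α, η, hα0, hα1, hη, hαη⟩ : ∃ α η : ℝ, 0 < α ∧ α < 1 ∧ 0 < η ∧
      1 - α = c * κ + 2 * η :=
    ⟨(1 - c * κ) / 2, (1 - c * κ) / 4, by linarith, by linarith, by linarith, by ring⟩
  set θ' : Fin K → unitInterval := Function.update θ k ⟨q, hq0.le, hq1.le⟩ with hθ'
  have hθk : (θ' k : ℝ) = q := by simp [hθ']
  have hne : ∀ a, a ≠ k → θ' a = θ a := fun a ha => by simp [hθ', ha]
  have hgap : ∀ a, a ≠ k → q - θ kstar ≤ (θ' k : ℝ) - θ' a := fun a ha => by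
    rw [hθk, hne a ha]
    exact sub_le_sub_left (Subtype.coe_le_coe.2 (hstar a)) _
  have huniq : ∀ a, a ≠ k → θ' a < θ' k := fun a ha =>
    Subtype.coe_lt_coe.1 (by linarith [hgap a ha])
  have hle : ∀ a, θ' a ≤ θ' k := fun a => by
    by_cases ha : a = k
    · rw [ha]
    · exact (huniq a ha).le
  set m := (∑' n : ℕ, (n : ENNReal) * δ n).toReal
  have hlogT : Tendsto (fun T : ℕ => Real.log T) atTop atTop :=
    Real.tendsto_log_atTop.comp tendsto_natCast_atTop_atTop
  have hrem : Tendsto (fun T : ℕ => (regret θ' δ k π T / (T : ℝ) ^ α + m * (T : ℝ) ^ (-α)) /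
      (q - θ kstar)) atTop (𝓝 0) := by
    have h1 := hπ θ' k huniq α hα0 hα1
    have h2 := ((tendsto_rpow_neg_atTop hα0).comp tendsto_natCast_atTop_atTop).const_mul m
    simpa using (h1.add h2).div_const (q - θ kstar)
  have hlogdiv : Tendsto (fun T : ℕ => c * ((1 - α) * (Real.log T / T))) atTop (𝓝 0) := by
    have h : Tendsto (fun x : ℝ => Real.log x / x) atTop (𝓝 0) :=
      Real.isLittleO_log_id_atTop.tendsto_div_nhds_zero
    simpa using ((h.comp tendsto_natCast_atTop_atTop).const_mul (1 - α)).const_mul c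
  filter_upwards [hrem.eventually (gt_mem_nhds zero_lt_one), hlogdiv.eventually (gt_mem_nhds hη),
    hlogT.eventually_gt_atTop (1 / η), eventually_gt_atTop 0] with T hT1 hT2 hT3 hT
  have hT' : (0 : ℝ) < T := by exact_mod_cast hT
  have hlog0 : 0 < Real.log T := lt_trans (by positivity) hT3
  have hηlog : 1 < η * Real.log T := by
    rwa [div_lt_iff₀ hη, mul_comm] at hT3
  have hx : 0 ≤ (1 - α) * Real.log T := mul_nonneg (by linarith) hlog0.le
  have hmain := mul_one_sub_expectedPlays_le θ θ' k hne (hθk ▸ hq0) (hθk ▸ hq1) δ π T hT _ hx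
  -- Under the lifted rates, each play of another arm costs at least `q - θ*`.
  have hoff : (q - θ kstar) * (T - expectedPlays θ' δ π k T) ≤ regret θ' δ k π T + m := by
    refine le_trans ?_ (regret_bounds θ' δ hmean k hle π T).2
    rw [← sum_ite_ne_expectedPlays]
    refine Finset.sum_le_sum fun a _ => ?_
    refine mul_le_mul_of_nonneg_right ?_ (expectedPlays_nonneg _ _ _ _ _)
    split_ifs with ha
    · simp [ha]
    · exact hgap a ha
  have hexp : Real.exp ((1 - α) * Real.log T) / T = (T : ℝ) ^ (-α) := by
    rw [mul_comm, ← Real.rpow_def_of_pos hT', ← Real.rpow_sub_one hT'.ne']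
    congr 1
    ring
  have hrem' : (T : ℝ) ^ (-α) * (T - expectedPlays θ' δ π k T) < 1 := by
    refine lt_of_le_of_lt ?_ hT1
    rw [le_div_iff₀ (sub_pos.2 hq), Real.rpow_neg hT'.le, div_eq_inv_mul, mul_comm m,
      ← mul_add, mul_assoc]
    refine mul_le_mul_of_nonneg_left ?_ (by positivity)
    linarith
  rw [hexp, hθk] at hmain
  change _ ≤ κ * _ + _ at hmain
  -- Otherwise `hmain` reads `(c κ + 2 η) log T < (c κ + η) log T + 1`, although `η log T > 1`.
  by_contra! hcon
  set n := expectedPlays θ δ π k T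
  have e1 : (1 - α) * Real.log T / T * (T - n) =
      (1 - α) * Real.log T - (1 - α) * (Real.log T / T) * n := by
    field_simp
  have hcoef : 0 ≤ κ + (1 - α) * (Real.log T / T) :=
    add_nonneg hκ (mul_nonneg (by linarith) (by positivity))
  have e2 := mul_le_mul_of_nonneg_left hcon.le hcoef
  have e3 : c * ((1 - α) * (Real.log T / T)) * Real.log T ≤ η * Real.log T :=
    mul_le_mul_of_nonneg_right hT2.le hlog0.le
  have e4 : (1 - α) * Real.log T = c * κ * Real.log T + 2 * (η * Real.log T) := by
    rw [hαη]; ring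
  nlinarith

lemma ereal_coe_sum {ι : Type*} (s : Finset ι) (f : ι → ℝ) :
    ((∑ i ∈ s, f i : ℝ) : EReal) = ∑ i ∈ s, (f i : EReal) := by
  classical
  induction s using Finset.induction_on with
  | empty => simp
  | insert i s hi ih => rw [Finset.sum_insert hi, Finset.sum_insert hi, EReal.coe_add, ih]

end DelayedBandit

end

theorem mainTheorem2 {K : ℕ} (δ : PMF ℕ)
    (hmean : ∑' n : ℕ, (n : ENNReal) * δ n ≠ ⊤)
    (π : DelayedBandit.Policy K) (hπ : DelayedBandit.UniformlyEfficient δ π)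
    (θ : Fin K → unitInterval) (kstar : Fin K) (hstar : ∀ k, θ k ≤ θ kstar) :
    ∑ k : Fin K with θ k < θ kstar,
        (((θ kstar : ℝ) - (θ k : ℝ) : ℝ) : EReal) /
          DelayedBandit.bernoulliKL (θ k : ℝ) (θ kstar : ℝ)
      ≤ liminf
          (fun T : ℕ =>
            ((DelayedBandit.regret θ δ kstar π T / Real.log (T : ℝ) : ℝ) : EReal)) atTop := by
  open DelayedBandit in
  rcases (θ kstar).2.2.eq_or_lt with h1 | h1
  · -- All divergences are infinite, so the sum vanishes.
    rw [Finset.sum_eq_zero]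
    · refine le_liminf_of_le (by isBoundedDefault) (Eventually.of_forall fun T => ?_)
      exact_mod_cast div_nonneg (regret_bounds θ δ hmean kstar hstar π T).1
        (Real.log_natCast_nonneg T)
    · intro k hk
      have hk' : (θ k : ℝ) < θ kstar := (Finset.mem_filter.1 hk).2
      rw [bernoulliKL, if_pos (Or.inr ⟨h1, by linarith⟩), EReal.div_top]
  · set S := Finset.univ.filter fun k : Fin K => θ k < θ kstar with hS
    have hkpos : ∀ k ∈ S, 0 < realKL (θ k) (θ kstar) := fun k hk =>
      realKL_pos (θ k).2.1 (Finset.mem_filter.1 hk).2 h1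
    have hsum : (∑ k ∈ S, (((θ kstar : ℝ) - (θ k : ℝ) : ℝ) : EReal) /
        bernoulliKL (θ k : ℝ) (θ kstar : ℝ)) =
        ((∑ k ∈ S, ((θ kstar : ℝ) - θ k) * (realKL (θ k) (θ kstar))⁻¹ : ℝ) : EReal) := by
      rw [ereal_coe_sum]
      refine Finset.sum_congr rfl fun k hk => ?_
      have hk' : (θ k : ℝ) < θ kstar := (Finset.mem_filter.1 hk).2
      have h0 : (0 : ℝ) < θ kstar := (θ k).2.1.trans_lt hk'
      rw [bernoulliKL, if_neg (by rintro (h | h) <;> linarith [h.1]), ← EReal.coe_div,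
        div_eq_mul_inv]
      rfl
    rw [hsum]
    set m := (∑' n : ℕ, (n : ENNReal) * δ n).toReal
    have hlogT : Tendsto (fun T : ℕ => Real.log T) atTop atTop :=
      Real.tendsto_log_atTop.comp tendsto_natCast_atTop_atTop
    -- The frequencies of plays are truncated at their asymptotic lower bounds.
    have hmin : ∀ k ∈ S, Tendsto (fun T : ℕ => min (expectedPlays θ δ π k T / Real.log T)
        (realKL (θ k) (θ kstar))⁻¹) atTop (𝓝 (realKL (θ k) (θ kstar))⁻¹) := by
      intro k hk
      have hpos := hkpos k hk
      refine tendsto_order.2 ⟨fun b hb => ?_, fun b hb =>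
        Eventually.of_forall fun T => (min_le_right _ _).trans_lt hb⟩
      obtain ⟨c, hbc, hc⟩ := exists_between (max_lt hb (inv_pos.2 hpos))
      have hc' : c * realKL (θ k) (θ kstar) < 1 := by
        rwa [lt_inv_comm₀ ((le_max_right b 0).trans_lt hbc) hpos,
          ← one_div, lt_div_iff₀ ((le_max_right b 0).trans_lt hbc), mul_comm] at hc
      filter_upwards [eventually_mul_log_le_expectedPlays δ hmean π hπ θ kstar hstar h1 k
        (Finset.mem_filter.1 hk).2 c ((le_max_right b 0).trans_lt hbc).le hc',
        hlogT.eventually_gt_atTop 0] with T hT hT0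
      exact lt_min (((le_max_left b 0).trans_lt hbc).trans_le ((le_div_iff₀ hT0).2 hT)) hb
    have hlim : Tendsto (fun T : ℕ => (((∑ k ∈ S, ((θ kstar : ℝ) - θ k) *
        min (expectedPlays θ δ π k T / Real.log T) (realKL (θ k) (θ kstar))⁻¹) -
          m / Real.log T : ℝ) : EReal)) atTop
        (𝓝 ((∑ k ∈ S, ((θ kstar : ℝ) - θ k) * (realKL (θ k) (θ kstar))⁻¹ : ℝ) : EReal)) := by
      refine (continuous_coe_real_ereal.tendsto _).comp ?_
      simpa using (tendsto_finsetSum S fun k hk => (hmin k hk).const_mul _).sub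
        (hlogT.const_div_atTop m)
    rw [← hlim.liminf_eq]
    refine liminf_le_liminf ?_
    filter_upwards [hlogT.eventually_gt_atTop 0] with T hT
    rw [EReal.coe_le_coe_iff, sub_le_iff_le_add, ← add_div, le_div_iff₀ hT, Finset.sum_mul]
    refine le_trans ?_ (regret_bounds θ δ hmean kstar hstar π T).2
    refine (Finset.sum_le_sum fun k _ => ?_).trans (Finset.sum_le_sum_of_subset_of_nonneg
      (Finset.subset_univ S) fun k _ _ =>
        mul_nonneg (sub_nonneg.2 (hstar k)) (expectedPlays_nonneg _ _ _ _ _))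
    rw [mul_assoc]
    refine mul_le_mul_of_nonneg_left ?_ (sub_nonneg.2 (hstar k))
    exact (le_div_iff₀ hT).1 (min_le_left _ _)
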